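/- Let $E$ be a real or complex Banach space. Call a bounded linear operator $T:E\to F$ into a Banach space $F$ upper semi-Fredholm (USF) if $\ker T$ is finite dimensional and the range $TE$ is closed. A sequence in $E$ is basic if it is a Schauder basis of its closed linear span, and it is normalized if all its terms have norm $1$. Then $E$ is reflexive if and only if, for every Banach space $F$ (over the same scalar field) and every bounded linear operator $T:E\to F$, the following two conditions are equivalent: (a) $T$ is USF; (b) there is $\delta>0$ such that no normalized basic sequence $(e_n)_{n\in\mathbb N}$ in $E$ satisfies $\|Te_n\|<\delta$ for all $n\in\mathbb N$. -/

import Mathlib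

universe u v

/-- A normed space is reflexive if the canonical map into its bidual is onto. -/
def IsReflexiveSpace (𝕜 : Type*) [RCLike 𝕜] (E : Type*) [NormedAddCommGroup E]
    [NormedSpace 𝕜 E] : Prop :=
  Function.Surjective (NormedSpace.inclusionInDoubleDual 𝕜 E)

/-- A bounded operator is upper semi-Fredholm (USF) if its kernel is finite dimensional and its
range is closed. -/
def IsUpperSemiFredholm {𝕜 : Type*} [RCLike 𝕜] {E F : Type*}
    [NormedAddCommGroup E] [NormedSpace 𝕜 E] [NormedAddCommGroup F] [NormedSpace 𝕜 F]
    (T : E →L[𝕜] F) : Prop :=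
  FiniteDimensional 𝕜 (LinearMap.ker (T : E →ₗ[𝕜] F)) ∧ IsClosed (Set.range T)

/-- A sequence is basic if it is a Schauder basis of its closed linear span. -/
def IsBasicSequence (𝕜 : Type*) [RCLike 𝕜] {E : Type*} [NormedAddCommGroup E]
    [NormedSpace 𝕜 E] (e : ℕ → E) : Prop :=
  ∃ b : SchauderBasis 𝕜 (Submodule.span 𝕜 (Set.range e)).topologicalClosure,
    ∀ n, (b n : E) = e n

/-! Basic sequences are produced by Grunblum's criterion together with Mazur's construction, which
picks each vector in the kernel of finitely many functionals norming the span of the earlier ones.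
If `T` is not USF, it is not bounded below on any finite-codimensional common kernel, so Mazur's
vectors can be unit vectors with small images; reflexivity plays no role here.

In a reflexive space normalized basic sequences are weakly null. If `T` is USF and small on such a
sequence, its terms lie near the finite-dimensional kernel, where weak and norm limits agree: a
contradiction.

If `E` is not reflexive, a bidual element outside `E` and Helly's theorem give a bounded basic
sequence `x n` with `f (x n) = 1`. The projection onto `ker f` along `u = x 0` is USF, yet small on
the normalized basic sequence obtained from `u + t • x n` for small `t`. -/

open Filter Topology

/-! ### Grunblum's criterion -/

/-- Grunblum's condition: initial partial sums of a linear combination of the `e i` are bounded by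
`K` times the whole combination. -/
def PartialSumsBounded (𝕜 : Type*) [RCLike 𝕜] {X : Type*} [NormedAddCommGroup X]
    [NormedSpace 𝕜 X] (K : ℝ) (e : ℕ → X) : Prop :=
  ∀ (a : ℕ → 𝕜) (m n : ℕ), m ≤ n →
    ‖∑ i ∈ Finset.range m, a i • e i‖ ≤ K * ‖∑ i ∈ Finset.range n, a i • e i‖

namespace PartialSumsBounded

variable {𝕜 : Type*} [RCLike 𝕜] {X Y : Type*} [NormedAddCommGroup X] [NormedSpace 𝕜 X]
  [NormedAddCommGroup Y] [NormedSpace 𝕜 Y] {K : ℝ} {e : ℕ → X}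

theorem of_map (A : X →L[𝕜] Y) {C : ℝ} (hA : ∀ x, ‖x‖ ≤ C * ‖A x‖) (hC : 0 ≤ C) (hK : 0 ≤ K)
    (h : PartialSumsBounded 𝕜 K (fun n ↦ A (e n))) :
    PartialSumsBounded 𝕜 (C * (K * ‖A‖)) e := by
  intro a m n hmn
  have hs : ∀ k, A (∑ i ∈ Finset.range k, a i • e i) = ∑ i ∈ Finset.range k, a i • A (e i) := by
    intro k; simp
  calc ‖∑ i ∈ Finset.range m, a i • e i‖
      ≤ C * ‖A (∑ i ∈ Finset.range m, a i • e i)‖ := hA _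
    _ ≤ C * (K * ‖A (∑ i ∈ Finset.range n, a i • e i)‖) := by
        rw [hs, hs]; gcongr; exact h a m n hmn
    _ ≤ C * (K * (‖A‖ * ‖∑ i ∈ Finset.range n, a i • e i‖)) := by
        gcongr; exact A.le_opNorm _
    _ = _ := by ring

theorem smul (h : PartialSumsBounded 𝕜 K e) (c : ℕ → 𝕜) :
    PartialSumsBounded 𝕜 K (fun n ↦ c n • e n) := by
  intro a m n hmn
  simpa [smul_smul] using h (fun i ↦ a i * c i) m n hmn

theorem sum_le (h : PartialSumsBounded 𝕜 K e) (a : ℕ →₀ 𝕜) (m : ℕ) :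
    ‖∑ i ∈ Finset.range m, a i • e i‖ ≤ K * ‖Finsupp.linearCombination 𝕜 e a‖ := by
  obtain ⟨n, hn⟩ := a.support.exists_nat_subset_range
  have h1 : Finsupp.linearCombination 𝕜 e a = ∑ i ∈ Finset.range (max m n), a i • e i := by
    rw [Finsupp.linearCombination_apply]
    refine Finsupp.sum_of_support_subset _
      (hn.trans (Finset.range_subset_range.2 (le_max_right _ _))) _ (by simp)
  rw [h1]
  exact h a m _ (le_max_left _ _)

theorem coeff_le (h : PartialSumsBounded 𝕜 K e) (a : ℕ →₀ 𝕜) (m : ℕ) :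
    ‖a m‖ * ‖e m‖ ≤ 2 * K * ‖Finsupp.linearCombination 𝕜 e a‖ := by
  have h1 : a m • e m =
      ∑ i ∈ Finset.range (m + 1), a i • e i - ∑ i ∈ Finset.range m, a i • e i := by
    rw [Finset.sum_range_succ]; abel
  rw [← norm_smul, h1]
  have := h.sum_le a m
  have := h.sum_le a (m + 1)
  have := norm_sub_le (∑ i ∈ Finset.range (m + 1), a i • e i) (∑ i ∈ Finset.range m, a i • e i)
  linarith

/-- A total sequence of nonzero vectors satisfying Grunblum's condition is a Schauder basis. -/
theorem exists_schauderBasis (h : PartialSumsBounded 𝕜 K e) (he : ∀ n, e n ≠ 0)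
    (hd : DenseRange (Finsupp.linearCombination 𝕜 e)) :
    ∃ b : SchauderBasis 𝕜 X, ∀ n, b n = e n := by
  set L := Finsupp.linearCombination 𝕜 e with hL
  have hbd : ∀ n, ∀ a : ℕ →₀ 𝕜,
      ‖(Finsupp.lapply n : (ℕ →₀ 𝕜) →ₗ[𝕜] 𝕜) a‖ ≤ (2 * K / ‖e n‖) * ‖L a‖ := by
    intro n a
    have := h.coeff_le a n
    rw [div_mul_eq_mul_div, le_div_iff₀ (norm_pos_iff.2 (he n))]
    simpa using this
  let c : ℕ → StrongDual 𝕜 X := fun n ↦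
    (Finsupp.lapply n : (ℕ →₀ 𝕜) →ₗ[𝕜] 𝕜).extendOfNorm L
  have hc : ∀ n a, c n (L a) = a n := fun n a ↦
    LinearMap.extendOfNorm_eq hd ⟨_, hbd n⟩ a
  have hLe : ∀ n, L (Finsupp.single n 1) = e n := by intro n; simp [hL]
  have hP : ∀ n x, ‖∑ i ∈ Finset.range n, c i x • e i‖ ≤ K * ‖x‖ := by
    intro n x
    refine hd.induction (P := fun x ↦ ‖∑ i ∈ Finset.range n, c i x • e i‖ ≤ K * ‖x‖) ?_ ?_ x
    · rintro _ ⟨a, rfl⟩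
      simp only [hc]
      exact h.sum_le a n
    · exact isClosed_le (by fun_prop) (by fun_prop)
  have hK : 0 ≤ K := by
    have := (norm_nonneg _).trans (hP 0 (e 0))
    exact nonneg_of_mul_nonneg_left this (norm_pos_iff.2 (he 0))
  refine ⟨⟨e, c, fun i j ↦ ?_, fun x ↦ ?_⟩, fun n ↦ rfl⟩
  · rw [← hLe, hc]
    simp [Finsupp.single_apply, Pi.single_apply, eq_comm]
  · rw [HasSum, SummationFilter.conditional_filter_eq_map_range, tendsto_map'_iff,
      Metric.tendsto_atTop]
    intro ε hε
    obtain ⟨a, ha⟩ := hd.exists_dist_lt x (ε := ε / (K + 1)) (by positivity)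
    obtain ⟨N, hN⟩ := a.support.exists_nat_subset_range
    refine ⟨N, fun n hn ↦ ?_⟩
    have hLa : L a = ∑ i ∈ Finset.range n, c i (L a) • e i := by
      simp only [hc]
      rw [hL, Finsupp.linearCombination_apply]
      exact Finsupp.sum_of_support_subset _
        (hN.trans (Finset.range_subset_range.2 hn)) _ (by simp)
    -- The partial sum reproduces `L a` exactly, so only the residual `x - L a` contributes, with
    -- factor at most `K + 1`.
    have h1 : (∑ i ∈ Finset.range n, c i x • e i) - x =
        (∑ i ∈ Finset.range n, c i (x - L a) • e i) - (x - L a) := by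
      simp only [map_sub, sub_smul, Finset.sum_sub_distrib]
      rw [← hLa]; abel
    simp only [Function.comp]
    rw [dist_eq_norm, h1]
    rw [dist_eq_norm] at ha
    calc _ ≤ ‖∑ i ∈ Finset.range n, c i (x - L a) • e i‖ + ‖x - L a‖ := norm_sub_le _ _
      _ ≤ K * ‖x - L a‖ + ‖x - L a‖ := by gcongr; exact hP n _
      _ = (K + 1) * ‖x - L a‖ := by ring
      _ < (K + 1) * (ε / (K + 1)) := by gcongr
      _ = ε := by field_simp

/-- **Grunblum's criterion** for basic sequences. -/
theorem isBasicSequence (h : PartialSumsBounded 𝕜 K e) (he : ∀ n, e n ≠ 0) :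
    IsBasicSequence 𝕜 e := by
  set M := (Submodule.span 𝕜 (Set.range e)).topologicalClosure
  have hmem : ∀ n, e n ∈ M := fun n ↦
    Submodule.le_topologicalClosure _ (Submodule.subset_span ⟨n, rfl⟩)
  let e' : ℕ → M := fun n ↦ ⟨e n, hmem n⟩
  have h' : PartialSumsBounded 𝕜 K e' := by
    intro a m n hmn
    simpa [e'] using h a m n hmn
  have hval : ∀ a, (Finsupp.linearCombination 𝕜 e' a : X) = Finsupp.linearCombination 𝕜 e a := by
    intro a
    simp [Finsupp.linearCombination_apply, Finsupp.sum, e']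
  have hd : DenseRange (Finsupp.linearCombination 𝕜 e') := by
    intro x
    rw [closure_subtype]
    have hx : (x : X) ∈ closure (Submodule.span 𝕜 (Set.range e) : Set X) := x.2
    refine closure_mono ?_ hx
    intro y hy
    obtain ⟨a, rfl⟩ := (Finsupp.mem_span_range_iff_exists_finsupp).1 hy
    exact ⟨_, ⟨a, rfl⟩, hval a⟩
  obtain ⟨b, hb⟩ := h'.exists_schauderBasis (fun n h0 ↦ he n (congrArg Subtype.val h0)) hd
  exact ⟨b, fun n ↦ congrArg Subtype.val (hb n)⟩

end PartialSumsBounded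

/-! ### Mazur's construction -/

/-- A norming family of functionals contains finitely many members that norm a given
finite-dimensional subspace. -/
theorem exists_finset_norming {𝕜 : Type*} [RCLike 𝕜] {X ι : Type*} [NormedAddCommGroup X]
    [NormedSpace 𝕜 X] (φ : ι → StrongDual 𝕜 X)
    (hφ : ∀ x, ∃ i, ‖φ i‖ ≤ 1 ∧ ‖x‖ ≤ 2 * ‖φ i x‖)
    (G : Submodule 𝕜 X) [FiniteDimensional 𝕜 G] :
    ∃ s : Finset ι, ∀ x ∈ G, ∀ y, (∀ i ∈ s, φ i y = φ i x) → ‖x‖ ≤ 4 * ‖y‖ := by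
  classical
  choose j hj1 hj2 using hφ
  have : ProperSpace G := FiniteDimensional.proper 𝕜 G
  -- A net point has norm at least 7/8, so its functional is at least 7/16 there; moving by 1/8
  -- leaves more than 1/4.
  obtain ⟨t, -, htfin, ht⟩ := (isCompact_sphere (0 : G) 1).finite_cover_balls
    (e := 1 / 8) (by norm_num)
  refine ⟨htfin.toFinset.image fun g : G ↦ j g, fun x hx y hy ↦ ?_⟩
  rcases eq_or_ne x 0 with rfl | hx0
  · simp
  have hxn : 0 < ‖x‖ := norm_pos_iff.2 hx0
  let c : 𝕜 := ((‖x‖⁻¹ : ℝ) : 𝕜)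
  have hcn : ‖c‖ = ‖x‖⁻¹ := by simp [c]
  have hu : ‖c • x‖ = 1 := by
    rw [norm_smul, hcn, inv_mul_cancel₀ hxn.ne']
  have hmem : (⟨c • x, G.smul_mem c hx⟩ : G) ∈ Metric.sphere (0 : G) 1 := by
    simpa using hu
  obtain ⟨g, hg, hgx⟩ := Set.mem_iUnion₂.1 (ht hmem)
  have hd : ‖c • x - (g : X)‖ < 1 / 8 := by
    simpa [dist_eq_norm] using hgx
  have hgn : 7 / 8 ≤ ‖(g : X)‖ := by
    have := norm_sub_norm_le (c • x) (g : X)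
    linarith
  have h1 : ‖φ (j g) g‖ ≤ ‖φ (j g) (c • x)‖ + ‖c • x - (g : X)‖ := by
    have h2 : φ (j g) g = φ (j g) (c • x) - φ (j g) (c • x - g) := by simp
    rw [h2]
    refine (norm_sub_le _ _).trans ?_
    gcongr
    simpa using (φ (j g)).le_of_opNorm_le (hj1 _) (c • x - g)
  have h3 := hj2 (g : X)
  have h4 : 1 / 4 ≤ ‖φ (j g) (c • x)‖ := by linarith
  have h5 : ‖φ (j g) (c • x)‖ ≤ ‖c‖ * ‖y‖ := by
    rw [map_smul, norm_smul, ← hy (j g) (Finset.mem_image.2 ⟨g, by simpa using hg, rfl⟩)]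
    gcongr
    simpa using (φ (j g)).le_of_opNorm_le (hj1 _) y
  rw [hcn] at h5
  have h6 : 1 / 4 ≤ ‖x‖⁻¹ * ‖y‖ := h4.trans h5
  rw [inv_mul_eq_div, le_div_iff₀ hxn] at h6
  linarith

/-- **Mazur's construction**: if vectors with property `P` can be found in the kernel of any finite
subset of a norming family of functionals, then some sequence of such vectors satisfies Grunblum's
condition. -/
theorem exists_partialSumsBounded {𝕜 : Type*} [RCLike 𝕜] {X ι : Type*} [NormedAddCommGroup X]
    [NormedSpace 𝕜 X] (φ : ι → StrongDual 𝕜 X)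
    (hφ : ∀ x, ∃ i, ‖φ i‖ ≤ 1 ∧ ‖x‖ ≤ 2 * ‖φ i x‖) (P : X → Prop)
    (hP : ∀ s : Finset ι, ∃ z, P z ∧ ∀ i ∈ s, φ i z = 0) :
    ∃ z : ℕ → X, (∀ n, P (z n)) ∧ PartialSumsBounded 𝕜 4 z := by
  classical
  -- Each stage carries a subspace, finitely many functionals norming it, and the new vector.
  obtain ⟨q, hq, hr⟩ := exists_seq_of_forall_finset_exists
    (α := Submodule 𝕜 X × Finset ι × X)
    (fun q ↦ FiniteDimensional 𝕜 q.1 ∧ q.2.2 ∈ q.1 ∧ P q.2.2 ∧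
      ∀ x ∈ q.1, ∀ y, (∀ i ∈ q.2.1, φ i y = φ i x) → ‖x‖ ≤ 4 * ‖y‖)
    (fun q r ↦ q.1 ≤ r.1 ∧ ∀ i ∈ q.2.1, φ i r.2.2 = 0) (by
      intro s hs
      obtain ⟨z, hz, hzs⟩ := hP (s.biUnion fun q ↦ q.2.1)
      let G : Submodule 𝕜 X := (s.sup fun q ↦ q.1) ⊔ 𝕜 ∙ z
      have : FiniteDimensional 𝕜 (s.sup fun q ↦ q.1 : Submodule 𝕜 X) :=
        (Submodule.fg_iff_finiteDimensional _).1 (Submodule.fg_finset_sup s _ fun q hq ↦ (Submodule.fg_iff_finiteDimensional _).2 (hs q hq).1)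
      have : FiniteDimensional 𝕜 G := Submodule.finite_sup _ _
      obtain ⟨t, ht⟩ := exists_finset_norming φ hφ G
      refine ⟨(G, t, z), ⟨this, ?_, hz, ht⟩, fun q hq ↦ ⟨?_, fun i hi ↦ ?_⟩⟩
      · exact Submodule.mem_sup_right (Submodule.mem_span_singleton_self z)
      · exact (Finset.le_sup (f := fun q : Submodule 𝕜 X × Finset ι × X ↦ q.1) hq).trans
          le_sup_left
      · exact hzs i (Finset.mem_biUnion.2 ⟨q, hq, hi⟩))
  refine ⟨fun n ↦ (q n).2.2, fun n ↦ (hq n).2.2.1, fun a m n hmn ↦ ?_⟩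
  rcases Nat.eq_zero_or_pos m with rfl | hm
  · simp
  obtain ⟨k, rfl⟩ := Nat.exists_eq_succ_of_ne_zero hm.ne'
  refine (hq k).2.2.2 _ (Submodule.sum_mem _ fun i hi ↦ Submodule.smul_mem _ _ ?_) _
    fun i hi ↦ ?_
  · rcases (Nat.lt_succ_iff.1 (Finset.mem_range.1 hi)).eq_or_lt with rfl | h
    · exact (hq _).2.1
    · exact (hr _ _ h).1 (hq i).2.1
  -- The functionals of stage `k = m - 1` annihilate every later vector, hence the whole tail.
  · rw [← Finset.sum_range_add_sum_Ico _ hmn, map_add, add_eq_left, map_sum]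
    refine Finset.sum_eq_zero fun l hl ↦ ?_
    rw [map_smul, (hr k l (Nat.lt_of_succ_le (Finset.mem_Ico.1 hl).1)).2 i hi, smul_zero]

/-! ### Operators that are not upper semi-Fredholm -/

/-- An operator that is bounded below on the common kernel of finitely many functionals is upper
semi-Fredholm. -/
theorem isUpperSemiFredholm_of_bound {𝕜 : Type*} [RCLike 𝕜] {E F : Type*} [NormedAddCommGroup E]
    [NormedSpace 𝕜 E] [CompleteSpace E] [NormedAddCommGroup F] [NormedSpace 𝕜 F]
    (T : E →L[𝕜] F) (s : Finset (StrongDual 𝕜 E)) {C : ℝ}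
    (h : ∀ x, (∀ f ∈ s, f x = 0) → ‖x‖ ≤ C * ‖T x‖) : IsUpperSemiFredholm T := by
  let A : E →L[𝕜] (s → 𝕜) := ContinuousLinearMap.pi fun f ↦ (f : StrongDual 𝕜 E)
  have hA : ∀ x, A x = 0 ↔ ∀ f ∈ s, f x = 0 := by
    intro x
    simp [A, funext_iff]
  let N : Submodule 𝕜 E := LinearMap.ker (A : E →ₗ[𝕜] (s → 𝕜))
  have hN : ∀ x ∈ N, ‖x‖ ≤ C * ‖T x‖ := fun x hx ↦ h x ((hA x).1 hx)
  have hNc : IsClosed (N : Set E) := A.isClosed_ker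
  constructor
  · let B : LinearMap.ker (T : E →ₗ[𝕜] F) →ₗ[𝕜] (s → 𝕜) :=
      (A : E →ₗ[𝕜] (s → 𝕜)).comp (Submodule.subtype _)
    refine FiniteDimensional.of_injective B ((injective_iff_map_eq_zero B).2 fun x hx ↦ ?_)
    have h1 := hN x hx
    have h2 : T x = 0 := x.2
    rw [h2] at h1
    simpa using h1
  · have : N.CoFG := Submodule.CoFG.ker _
    have hcl : IsClosed (N.map (T : E →ₗ[𝕜] F) : Set F) := by
      have : CompleteSpace N := hNc.completeSpace_coe
      let S : N →L[𝕜] F := T.comp N.subtypeL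
      have hS : AntilipschitzWith C.toNNReal S := by
        refine AddMonoidHomClass.antilipschitz_of_bound S fun x ↦ ?_
        refine (hN x x.2).trans ?_
        gcongr
        · exact Real.le_coe_toNNReal C
        · exact le_rfl
      have h1 := hS.isClosed_range S.uniformContinuous
      convert h1 using 1
      ext y
      simp [S]
    exact LinearMap.isClosed_range_of_isClosed_map_of_finiteDimensional_quotient hcl

/-- An operator that is not upper semi-Fredholm is small on the terms of some normalized basic
sequence. -/
theorem exists_isBasicSequence_of_not_isUpperSemiFredholm {𝕜 : Type*} [RCLike 𝕜] {E F : Type*}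
    [NormedAddCommGroup E] [NormedSpace 𝕜 E] [CompleteSpace E] [NormedAddCommGroup F]
    [NormedSpace 𝕜 F] (T : E →L[𝕜] F) (hT : ¬ IsUpperSemiFredholm T) {δ : ℝ} (hδ : 0 < δ) :
    ∃ e : ℕ → E, IsBasicSequence 𝕜 e ∧ (∀ n, ‖e n‖ = 1) ∧ ∀ n, ‖T (e n)‖ < δ := by
  obtain ⟨e, he, hb⟩ := exists_partialSumsBounded (𝕜 := 𝕜) (X := E) (ι := StrongDual 𝕜 E) id
    (fun x ↦ by
      obtain ⟨g, hg, hgx⟩ := exists_dual_vector'' 𝕜 x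
      refine ⟨g, hg, ?_⟩
      simp only [id, hgx]
      have := norm_nonneg x
      simp; linarith)
    (fun z ↦ ‖z‖ = 1 ∧ ‖T z‖ < δ) (by
      intro s
      by_contra! hcon
      refine hT (isUpperSemiFredholm_of_bound T s (C := δ⁻¹) fun x hx ↦ ?_)
      rcases eq_or_ne x 0 with rfl | hx0
      · simp
      have hxn : 0 < ‖x‖ := norm_pos_iff.2 hx0
      by_contra! hlt
      have hlt' : ‖T x‖ < δ * ‖x‖ := by
        rwa [inv_mul_lt_iff₀ hδ] at hlt
      let c : 𝕜 := ((‖x‖⁻¹ : ℝ) : 𝕜)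
      have hcn : ‖c‖ = ‖x‖⁻¹ := by simp [c]
      obtain ⟨f, hf, hfx⟩ := hcon (c • x) ⟨by rw [norm_smul, hcn, inv_mul_cancel₀ hxn.ne'], by
        rw [map_smul, norm_smul, hcn, inv_mul_lt_iff₀ hxn]; linarith⟩
      exact hfx (by simp [hx f hf]))
  exact ⟨e, hb.isBasicSequence fun n h0 ↦ by simpa [h0] using (he n).1, fun n ↦ (he n).1,
    fun n ↦ (he n).2⟩

/-! ### Helly's theorem and the reflexive case -/

/-- **Helly's theorem** on the finite solvability of moment problems. -/
theorem exists_eq_bidual {𝕜 : Type*} [RCLike 𝕜] {E : Type*} [NormedAddCommGroup E]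
    [NormedSpace 𝕜 E] (Φ : StrongDual 𝕜 (StrongDual 𝕜 E)) (s : Finset (StrongDual 𝕜 E)) :
    ∃ x : E, ‖x‖ ≤ ‖Φ‖ + 1 ∧ ∀ f ∈ s, f x = Φ f := by
  let A : E →L[𝕜] (s → 𝕜) := ContinuousLinearMap.pi fun f ↦ (f : StrongDual 𝕜 E)
  obtain ⟨x₀, hx₀⟩ : ∃ x₀, ∀ f ∈ s, f x₀ = Φ f := by
    by_contra! hcon
    have hv : (fun f : s ↦ Φ f) ∉ LinearMap.range (A : E →ₗ[𝕜] (s → 𝕜)) := by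
      rintro ⟨x, hx⟩
      obtain ⟨f, hf, hne⟩ := hcon x
      exact hne (congrFun hx ⟨f, hf⟩)
    -- The separating `c` encodes a linear relation among the members of `s` that `Φ` would have to
    -- violate.
    obtain ⟨c, hc, hker⟩ := Submodule.exists_le_ker_of_notMem hv
    classical
    have hexp : ∀ w : s → 𝕜, c w = ∑ f : s, w f • c fun i ↦ if f = i then 1 else 0 :=
      LinearMap.pi_apply_eq_sum_univ c
    have h0 : ∑ f : s, (c fun i ↦ if f = i then 1 else 0) • (f : StrongDual 𝕜 E) = 0 := by
      ext x
      have h1 : c (A x) = 0 := hker ⟨x, rfl⟩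
      rw [hexp] at h1
      simpa [A, mul_comm] using h1
    apply hc
    have h2 := congrArg Φ h0
    rw [hexp]
    simpa [mul_comm] using h2
  let N : Submodule 𝕜 E := LinearMap.ker (A : E →ₗ[𝕜] (s → 𝕜))
  have : IsClosed (N : Set E) := A.isClosed_ker
  have hq : ‖(Submodule.Quotient.mk x₀ : E ⧸ N)‖ ≤ ‖Φ‖ := by
    obtain ⟨g, hg, hgx⟩ := exists_dual_vector'' 𝕜 (Submodule.Quotient.mk x₀ : E ⧸ N)
    let π : E →L[𝕜] E ⧸ N := N.mkQL
    have hπ : ‖g.comp π‖ ≤ 1 := by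
      refine ContinuousLinearMap.opNorm_le_bound _ zero_le_one fun x ↦ ?_
      calc ‖g (π x)‖ ≤ 1 * ‖π x‖ := g.le_of_opNorm_le hg _
        _ ≤ 1 * ‖x‖ := by gcongr; exact Submodule.Quotient.norm_mk_le _ x
    -- A functional vanishing on `N` is a combination of members of `s`, so `Φ` evaluates it as `x₀`
    -- does.
    have hspan : (g.comp π : StrongDual 𝕜 E).toLinearMap ∈
        Submodule.span 𝕜 (Set.range fun f : s ↦ (f : StrongDual 𝕜 E).toLinearMap) := by
      refine mem_span_of_iInf_ker_le_ker fun x hx ↦ ?_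
      have hxN : x ∈ N := by
        show A x = 0
        ext f
        exact (Submodule.mem_iInf _).1 hx f
      have : π x = 0 := (Submodule.Quotient.mk_eq_zero N).2 hxN
      show g (π x) = 0
      simp [this]
    obtain ⟨c, hc⟩ := (Submodule.mem_span_range_iff_exists_fun 𝕜).1 hspan
    have hc' : ∑ f : s, c f • (f : StrongDual 𝕜 E) = g.comp π := by
      ext x
      simpa using LinearMap.congr_fun hc x
    have hΦ : Φ (g.comp π) = g.comp π x₀ := by
      rw [← hc']
      simp [hx₀]
    have h1 : ‖Φ (g.comp π)‖ = ‖(Submodule.Quotient.mk x₀ : E ⧸ N)‖ := by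
      rw [hΦ]
      show ‖g (Submodule.Quotient.mk x₀ : E ⧸ N)‖ = _
      rw [hgx]; simp
    rw [← h1]
    calc _ ≤ ‖Φ‖ * ‖g.comp π‖ := Φ.le_opNorm _
      _ ≤ ‖Φ‖ * 1 := by gcongr
      _ = _ := mul_one _
  obtain ⟨x, hx, hxn⟩ := Submodule.Quotient.norm_mk_lt (Submodule.Quotient.mk x₀ : E ⧸ N) one_pos
  refine ⟨x, by linarith, fun f hf ↦ ?_⟩
  have h1 : x - x₀ ∈ N := (Submodule.Quotient.eq N).1 hx
  have h2 : f (x - x₀) = 0 := congrFun (show A (x - x₀) = 0 from h1) ⟨f, hf⟩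
  rw [map_sub, sub_eq_zero] at h2
  rw [h2, hx₀ f hf]

/-- In a reflexive space every normalized basic sequence tends weakly to zero along the
hyperfilter. -/
theorem IsBasicSequence.tendsto_hyperfilter {𝕜 : Type*} [RCLike 𝕜] {E : Type*}
    [NormedAddCommGroup E] [NormedSpace 𝕜 E] (hE : IsReflexiveSpace 𝕜 E) {e : ℕ → E}
    (he : IsBasicSequence 𝕜 e) (hn : ∀ n, ‖e n‖ = 1) (g : StrongDual 𝕜 E) :
    Tendsto (fun n ↦ g (e n)) (hyperfilter ℕ : Filter ℕ) (𝓝 0) := by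
  obtain ⟨b, hb⟩ := he
  let J := NormedSpace.inclusionInDoubleDual 𝕜 E
  let Ψ : ℕ → WeakDual 𝕜 (StrongDual 𝕜 E) := fun n ↦ StrongDual.toWeakDual (J (e n))
  let B : Set (StrongDual 𝕜 E) := Metric.closedBall 0 1
  have hmem : ∀ n, Ψ n ∈ WeakDual.polar 𝕜 B := by
    intro n f hf
    calc ‖f (e n)‖ ≤ 1 * ‖e n‖ := f.le_of_opNorm_le (mem_closedBall_zero_iff.1 hf) _
      _ ≤ 1 := by rw [hn, one_mul]
  obtain ⟨Φ, -, hΦ⟩ := (WeakDual.isCompact_polar 𝕜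
    (Metric.closedBall_mem_nhds (0 : StrongDual 𝕜 E) one_pos)).ultrafilter_le_nhds
    ((hyperfilter ℕ).map Ψ) (le_principal_iff.2 (mem_map.2 (univ_mem' hmem)))
  obtain ⟨w, hw⟩ := hE (WeakDual.toStrongDual Φ)
  have hlim : ∀ f : StrongDual 𝕜 E,
      Tendsto (fun n ↦ f (e n)) (hyperfilter ℕ : Filter ℕ) (𝓝 (f w)) := by
    intro f
    have h1 : Tendsto (fun n ↦ (Ψ n) f) (hyperfilter ℕ : Filter ℕ) (𝓝 (Φ f)) :=
      ((WeakDual.eval_continuous f).tendsto Φ).comp hΦ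
    have h2 : Φ f = f w := by
      have := DFunLike.congr_fun hw f
      exact this.symm
    rw [h2] at h1
    exact h1
  let M := (Submodule.span 𝕜 (Set.range e)).topologicalClosure
  have hM : IsClosed (M : Set E) := Submodule.isClosed_topologicalClosure _
  -- The weak limit `w` stays in the closed span; there all its coordinates vanish, so `w = 0`.
  have hwM : w ∈ M := by
    by_contra hwM
    have hne : (Submodule.Quotient.mk w : E ⧸ M) ≠ 0 :=
      fun h ↦ hwM ((Submodule.Quotient.mk_eq_zero M).1 h)
    obtain ⟨f, hf⟩ := SeparatingDual.exists_ne_zero (R := 𝕜) hne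
    have h0 : ∀ n, (f.comp M.mkQL) (e n) = 0 := by
      intro n
      have : (Submodule.Quotient.mk (e n) : E ⧸ M) = 0 :=
        (Submodule.Quotient.mk_eq_zero M).2 (hb n ▸ (b n).2)
      show f (Submodule.Quotient.mk (e n)) = 0
      rw [this, map_zero]
    have h1 := hlim (f.comp M.mkQL)
    simp only [h0] at h1
    exact hf (tendsto_nhds_unique h1 tendsto_const_nhds)
  have hcoord : ∀ k, b.coord k ⟨w, hwM⟩ = 0 := by
    intro k
    obtain ⟨f, hf, -⟩ := exists_extension_norm_eq M (b.coord k)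
    have h1 := hlim f
    have h2 : ∀ᶠ n in (hyperfilter ℕ : Filter ℕ), f (e n) = 0 := by
      refine (hyperfilter_le_cofinite (α := ℕ)) ?_
      have : {k}ᶜ ∈ (cofinite : Filter ℕ) := (Set.finite_singleton k).compl_mem_cofinite
      filter_upwards [this] with n hnk
      rw [← hb n, hf, b.ortho]
      have hkn : k ≠ n := fun h ↦ hnk h.symm
      simp [hkn]
    have h3 : f w = 0 := tendsto_nhds_unique h1 
      (tendsto_const_nhds.congr' (h2.mono fun _ h ↦ h.symm))
    rw [← hf]; exact h3
  have hw0 : w = 0 := by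
    have h1 := b.expansion ⟨w, hwM⟩
    simp only [hcoord, zero_smul] at h1
    exact congrArg Subtype.val (h1.unique hasSum_zero)
  simpa [hw0] using hlim g

/-- On a reflexive space an upper semi-Fredholm operator is bounded away from zero on every
normalized basic sequence, uniformly. -/
theorem IsUpperSemiFredholm.exists_pos_of_isReflexiveSpace {𝕜 : Type*} [RCLike 𝕜] {E F : Type*}
    [NormedAddCommGroup E] [NormedSpace 𝕜 E] [CompleteSpace E] [NormedAddCommGroup F]
    [NormedSpace 𝕜 F] [CompleteSpace F] (hE : IsReflexiveSpace 𝕜 E) {T : E →L[𝕜] F}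
    (hT : IsUpperSemiFredholm T) :
    ∃ δ : ℝ, 0 < δ ∧
      ¬ ∃ e : ℕ → E, IsBasicSequence 𝕜 e ∧ (∀ n, ‖e n‖ = 1) ∧ ∀ n, ‖T (e n)‖ < δ := by
  obtain ⟨hker, hran⟩ := hT
  let R := LinearMap.range (T : E →ₗ[𝕜] F)
  have hR : IsClosed (R : Set F) := hran
  have : CompleteSpace R := hR.completeSpace_coe
  let S : E →L[𝕜] R := T.codRestrict R fun x ↦ ⟨x, rfl⟩
  have hS : Function.Surjective S := by
    rintro ⟨_, x, rfl⟩
    exact ⟨x, rfl⟩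
  obtain ⟨C, hC, hpre⟩ := S.exists_preimage_norm_le hS
  -- The corrections `x n` then have norm at most 1/3: the limit `y` of `e n - x n` has norm at
  -- least 2/3, but weak nullity of `e n` forces at most 1/3.
  refine ⟨1 / (3 * C), by positivity, ?_⟩
  rintro ⟨e, he, hn, hδ⟩
  choose x hx hxn using fun n ↦ hpre (S (e n))
  have hxn' : ∀ n, ‖x n‖ ≤ 1 / 3 := by
    intro n
    have h1 : ‖S (e n)‖ ≤ 1 / (3 * C) := (hδ n).le
    calc ‖x n‖ ≤ C * ‖S (e n)‖ := hxn n
      _ ≤ C * (1 / (3 * C)) := by gcongr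
      _ = 1 / 3 := by field_simp
  let N := LinearMap.ker (T : E →ₗ[𝕜] F)
  have hk : ∀ n, e n - x n ∈ N := by
    intro n
    have h1 : T (x n) = T (e n) := congrArg Subtype.val (hx n)
    show T (e n - x n) = 0
    rw [map_sub, h1, sub_self]
  let k : ℕ → N := fun n ↦ ⟨e n - x n, hk n⟩
  have : FiniteDimensional 𝕜 N := hker
  have : ProperSpace N := FiniteDimensional.proper 𝕜 N
  have hkmem : ∀ n, k n ∈ Metric.closedBall (0 : N) 2 := by
    intro n
    have h1 : ‖e n - x n‖ ≤ 2 := by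
      have := norm_sub_le (e n) (x n)
      have := hn n
      have := hxn' n
      linarith
    simpa [k] using h1
  obtain ⟨y, -, hy⟩ := (isCompact_closedBall (0 : N) 2).ultrafilter_le_nhds
    ((hyperfilter ℕ).map k) (le_principal_iff.2 (mem_map.2 (univ_mem' hkmem)))
  have hlim : Tendsto (fun n ↦ e n - x n) (hyperfilter ℕ : Filter ℕ) (𝓝 (y : E)) :=
    (continuous_subtype_val.tendsto y).comp hy
  have hlow : 2 / 3 ≤ ‖(y : E)‖ := by
    refine ge_of_tendsto' hlim.norm fun n ↦ ?_
    have := norm_sub_norm_le (e n) (x n)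
    have := hn n
    have := hxn' n
    linarith
  obtain ⟨g, hg, hgy⟩ := exists_dual_vector'' 𝕜 (y : E)
  have h1 : Tendsto (fun n ↦ g (x n)) (hyperfilter ℕ : Filter ℕ) (𝓝 (0 - g y)) := by
    have := (he.tendsto_hyperfilter hE hn g).sub ((g.continuous.tendsto _).comp hlim)
    simpa using this
  have h2 : ‖(0 : 𝕜) - g y‖ ≤ 1 / 3 := by
    refine le_of_tendsto' h1.norm fun n ↦ ?_
    calc ‖g (x n)‖ ≤ 1 * ‖x n‖ := g.le_of_opNorm_le hg _
      _ ≤ 1 / 3 := by rw [one_mul]; exact hxn' n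
  rw [hgy] at h2
  simp at h2
  linarith

/-! ### The nonreflexive case -/

/-- Let `J` embed `E` isometrically into `Y`, and let `Φ` lie outside the range of `J`. If bounded
sets of `E` solve all finite moment problems posed by `Φ` and a norming family, together with
`f v = 1`, then `E` contains a bounded sequence with `f (x n) = 1` satisfying Grunblum's
condition. -/
theorem exists_partialSumsBounded_of_moments {𝕜 : Type*} [RCLike 𝕜] {E Y ι : Type*}
    [NormedAddCommGroup E] [NormedSpace 𝕜 E] [CompleteSpace E] [NormedAddCommGroup Y]
    [NormedSpace 𝕜 Y] (J : E →ₗᵢ[𝕜] Y) (Φ : Y) (hΦ : ∀ v, J v ≠ Φ) (φ : ι → StrongDual 𝕜 Y)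
    (hφ : ∀ y, ∃ i, ‖φ i‖ ≤ 1 ∧ ‖y‖ ≤ 2 * ‖φ i y‖) (f : StrongDual 𝕜 E) {C : ℝ}
    (hmom : ∀ s : Finset ι, ∃ v, ‖v‖ ≤ C ∧ f v = 1 ∧ ∀ i ∈ s, φ i (J v) = φ i Φ) :
    ∃ (K : ℝ) (x : ℕ → E), 0 ≤ K ∧
      (∀ n, ‖x n‖ ≤ C) ∧ (∀ n, f (x n) = 1) ∧ PartialSumsBounded 𝕜 K x := by
  obtain ⟨d, hd, hdist⟩ : ∃ d > 0, ∀ v, d ≤ ‖J v - Φ‖ := by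
    have hcl : IsClosed (Set.range J) := J.isometry.isClosedEmbedding.isClosed_range
    obtain ⟨d, hd, hball⟩ := Metric.isOpen_iff.1 hcl.isOpen_compl Φ (by
      rintro ⟨v, hv⟩
      exact hΦ v hv)
    refine ⟨d, hd, fun v ↦ ?_⟩
    by_contra! h
    exact hball (by rwa [Metric.mem_ball, dist_eq_norm]) ⟨v, rfl⟩
  -- When `f v = 1`, `R v = J v - Φ`, which the moment conditions put in the required kernels. `R`
  -- is bounded below because `Φ` has positive distance from the range of `J`.
  let R : E →L[𝕜] Y := J.toContinuousLinearMap - f.smulRight Φ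
  have hRv : ∀ v, R v = J v - f v • Φ := fun v ↦ by simp [R]
  have hR : ∀ v, ‖v‖ ≤ (1 + ‖Φ‖ / d) * ‖R v‖ := by
    intro v
    have h1 : ‖f v‖ * d ≤ ‖R v‖ := by
      rcases eq_or_ne (f v) 0 with h0 | h0
      · simp [h0]
      · have h2 : R v = f v • (J ((f v)⁻¹ • v) - Φ) := by
          rw [hRv, map_smul, smul_sub, smul_inv_smul₀ h0]
        rw [h2, norm_smul]
        gcongr
        exact hdist _
    have h3 : ‖v‖ ≤ ‖R v‖ + ‖f v‖ * ‖Φ‖ := by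
      have : J v = R v + f v • Φ := by rw [hRv]; abel
      rw [← J.norm_map v, this, ← norm_smul]
      exact norm_add_le _ _
    have h4 : ‖f v‖ * ‖Φ‖ ≤ ‖Φ‖ / d * ‖R v‖ := by
      rw [div_mul_eq_mul_div, le_div_iff₀ hd]
      nlinarith [norm_nonneg Φ]
    linarith
  obtain ⟨z, hz, hb⟩ := exists_partialSumsBounded φ hφ
    (fun z ↦ ∃ v, z = R v ∧ ‖v‖ ≤ C ∧ f v = 1) (by
      intro s
      obtain ⟨v, hv, hfv, hvs⟩ := hmom s
      refine ⟨R v, ⟨v, rfl, hv, hfv⟩, fun i hi ↦ ?_⟩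
      rw [hRv, hfv, one_smul, map_sub, hvs i hi, sub_self])
  choose x hx hxn hfx using hz
  obtain rfl : z = fun n ↦ R (x n) := funext hx
  exact ⟨_, x, by positivity, hxn, hfx, hb.of_map R hR (by positivity) (by norm_num)⟩

/-- A nonreflexive Banach space contains a bounded sequence on which some functional is constantly
one and which satisfies Grunblum's condition. -/
theorem exists_partialSumsBounded_of_not_isReflexiveSpace {𝕜 : Type*} [RCLike 𝕜] {E : Type*}
    [NormedAddCommGroup E] [NormedSpace 𝕜 E] [CompleteSpace E] (hE : ¬ IsReflexiveSpace 𝕜 E) :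
    ∃ (f : StrongDual 𝕜 E) (C K : ℝ) (x : ℕ → E), 0 ≤ K ∧
      (∀ n, ‖x n‖ ≤ C) ∧ (∀ n, f (x n) = 1) ∧ PartialSumsBounded 𝕜 K x := by
  classical
  let J := NormedSpace.inclusionInDoubleDualLi (E := E) 𝕜
  obtain ⟨Φ, hΦ⟩ : ∃ Φ, ∀ v, J v ≠ Φ := by
    by_contra! h
    exact hE h
  obtain ⟨f, hf⟩ : ∃ f, Φ f = 1 := by
    obtain ⟨f, hf⟩ : ∃ f, Φ f ≠ 0 := by
      by_contra! h
      exact hΦ 0 (J.toLinearMap.map_zero.trans (ContinuousLinearMap.ext fun f ↦ (h f).symm))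
    exact ⟨(Φ f)⁻¹ • f, by rw [map_smul, smul_eq_mul, inv_mul_cancel₀ hf]⟩
  refine ⟨f, ‖Φ‖ + 1, exists_partialSumsBounded_of_moments J Φ hΦ
    (NormedSpace.inclusionInDoubleDual 𝕜 (StrongDual 𝕜 E)) (fun Ψ ↦ ?_) f fun s ↦ ?_⟩
  · rcases le_or_gt ‖Ψ‖ 0 with h0 | hpos
    · refine ⟨0, ?_, h0.trans (by positivity)⟩
      rw [map_zero, norm_zero]
      exact zero_le_one
    obtain ⟨g, hg1, hg2⟩ := Ψ.exists_lt_apply_of_lt_opNorm (r := ‖Ψ‖ / 2) (by linarith)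
    refine ⟨g, (NormedSpace.double_dual_bound 𝕜 _ g).trans hg1.le, ?_⟩
    rw [NormedSpace.dual_def]
    linarith
  · obtain ⟨v, hv, hvs⟩ := exists_eq_bidual Φ (insert f s)
    refine ⟨v, hv, by rw [hvs f (Finset.mem_insert_self _ _), hf], fun g hg ↦ ?_⟩
    exact hvs g (Finset.mem_insert_of_mem hg)

/-- On a nonreflexive Banach space some upper semi-Fredholm operator is arbitrarily small on
normalized basic sequences. -/
theorem exists_isUpperSemiFredholm_of_not_isReflexiveSpace {𝕜 : Type*} [RCLike 𝕜] {E : Type*}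
    [NormedAddCommGroup E] [NormedSpace 𝕜 E] [CompleteSpace E] (hE : ¬ IsReflexiveSpace 𝕜 E) :
    ∃ T : E →L[𝕜] E, IsUpperSemiFredholm T ∧ ∀ δ : ℝ, 0 < δ →
      ∃ e : ℕ → E, IsBasicSequence 𝕜 e ∧ (∀ n, ‖e n‖ = 1) ∧ ∀ n, ‖T (e n)‖ < δ := by
  obtain ⟨f, C, K, x, hK, hxC, hfx, hb⟩ := exists_partialSumsBounded_of_not_isReflexiveSpace hE
  set u := x 0
  have hfu : f u = 1 := hfx 0
  have hu : 0 < ‖u‖ := norm_pos_iff.2 fun h ↦ by simp [h] at hfu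
  have hC : 0 < C := hu.trans_le (hxC 0)
  let T : E →L[𝕜] E := ContinuousLinearMap.id 𝕜 E - f.smulRight u
  have hTv : ∀ v, T v = v - f v • u := fun v ↦ by simp [T]
  refine ⟨T, ⟨?_, ?_⟩, fun δ hδ ↦ ?_⟩
  · have hle : LinearMap.ker (T : E →ₗ[𝕜] E) ≤ 𝕜 ∙ u := by
      intro v hv
      have h1 : T v = 0 := hv
      rw [hTv, sub_eq_zero] at h1
      exact Submodule.mem_span_singleton.2 ⟨f v, h1.symm⟩
    exact Submodule.finiteDimensional_of_le hle
  · have : Set.range T = {v | f v = 0} := by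
      ext v
      constructor
      · rintro ⟨w, rfl⟩
        simp [hTv, hfu]
      · intro hv
        exact ⟨v, by rw [hTv, show f v = 0 from hv]; simp⟩
    rw [this]
    exact isClosed_eq f.continuous continuous_const
  · obtain ⟨t, ht, ht1, ht2⟩ : ∃ t : ℝ, 0 < t ∧ t * C ≤ ‖u‖ / 2 ∧ t * (2 * C) < δ * (‖u‖ / 2) := by
      refine ⟨min (‖u‖ / (2 * C)) (δ * ‖u‖ / (8 * C)), by positivity, ?_, ?_⟩
      · calc _ ≤ ‖u‖ / (2 * C) * C := by gcongr; exact min_le_left _ _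
          _ = ‖u‖ / 2 := by field_simp
      · calc _ ≤ δ * ‖u‖ / (8 * C) * (2 * C) := by gcongr; exact min_le_right _ _
          _ = δ * (‖u‖ / 4) := by field_simp; norm_num
          _ < δ * (‖u‖ / 2) := by gcongr; norm_num
    let τ : 𝕜 := (t : 𝕜)
    have hτn : ‖τ‖ = t := by simp [τ, abs_of_pos ht]
    have hτ0 : τ ≠ 0 := norm_pos_iff.1 (hτn ▸ ht)
    have hτ1 : τ + 1 ≠ 0 := by
      have : ((t + 1 : ℝ) : 𝕜) ≠ 0 := by
        rw [RCLike.ofReal_ne_zero]; positivity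
      simpa [τ] using this
    let y : ℕ → E := fun n ↦ τ • x n + u
    have hfy : ∀ n, f (y n) = τ + 1 := fun n ↦ by simp [y, hfx, hfu]
    have hyn : ∀ n, ‖u‖ / 2 ≤ ‖y n‖ := by
      intro n
      have h1 : ‖u‖ ≤ ‖y n‖ + ‖τ • x n‖ := by
        have : u = y n - τ • x n := by simp [y]
        nth_rw 1 [this]
        exact norm_sub_le _ _
      have h2 : ‖τ • x n‖ ≤ t * C := by
        rw [norm_smul, hτn]; gcongr; exact hxC n
      linarith
    -- The inverse of `v ↦ τ • v + f v • u`, which carries `x n` to `y n`.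
    let A : E →L[𝕜] E := τ⁻¹ • (ContinuousLinearMap.id 𝕜 E - (τ + 1)⁻¹ • f.smulRight u)
    have hAv : ∀ v, A v = τ⁻¹ • (v - ((τ + 1)⁻¹ * f v) • u) := fun v ↦ by simp [A, smul_smul]
    have hAy : ∀ n, A (y n) = x n := by
      intro n
      rw [hAv, hfy, inv_mul_cancel₀ hτ1, one_smul]
      simp [y, hτ0]
    have hA : ∀ v, ‖v‖ ≤ (t + ‖f‖ * ‖u‖) * ‖A v‖ := by
      intro v
      have h1 : v = τ • A v + f (A v) • u := by
        have h2 : f (A v) = (τ + 1)⁻¹ * f v := by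
          rw [hAv]; simp [hfu]; field_simp; ring
        rw [h2, hAv, smul_inv_smul₀ hτ0, sub_add_cancel]
      calc ‖v‖ = ‖τ • A v + f (A v) • u‖ := by rw [← h1]
        _ ≤ ‖τ‖ * ‖A v‖ + ‖f (A v)‖ * ‖u‖ := by
            rw [← norm_smul, ← norm_smul]; exact norm_add_le _ _
        _ ≤ t * ‖A v‖ + (‖f‖ * ‖A v‖) * ‖u‖ := by
            rw [hτn]; gcongr; exact f.le_opNorm _
        _ = _ := by ring
    have hby := PartialSumsBounded.of_map (e := y) A hA (by positivity) hK (by simpa only [hAy])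
    have hypos : ∀ n, 0 < ‖y n‖ := fun n ↦ (half_pos hu).trans_le (hyn n)
    let c : ℕ → 𝕜 := fun n ↦ ((‖y n‖⁻¹ : ℝ) : 𝕜)
    have hcn : ∀ n, ‖c n‖ = ‖y n‖⁻¹ := fun n ↦ by simp [c]
    have hnorm : ∀ n, ‖c n • y n‖ = 1 := fun n ↦ by
      rw [norm_smul, hcn, inv_mul_cancel₀ (hypos n).ne']
    refine ⟨fun n ↦ c n • y n, (hby.smul c).isBasicSequence fun n h0 ↦ ?_, hnorm, fun n ↦ ?_⟩
    · have := hnorm n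
      rw [h0] at this
      simp at this
    · have hT : T (y n) = τ • (x n - u) := by
        rw [hTv, hfy]
        simp only [y]
        module
      rw [map_smul, norm_smul, hcn, hT, norm_smul, hτn, inv_mul_lt_iff₀ (hypos n)]
      have h1 : ‖x n - u‖ ≤ 2 * C := by
        have := norm_sub_le (x n) u
        have := hxC n
        have : ‖u‖ ≤ C := hxC 0
        linarith
      calc t * ‖x n - u‖ ≤ t * (2 * C) := by gcongr
        _ < δ * (‖u‖ / 2) := ht2
        _ ≤ δ * ‖y n‖ := by gcongr; exact hyn n
        _ = ‖y n‖ * δ := mul_comm _ _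

/-- Letting `F` range over the universe of `E` suffices, as the counterexample operator maps `E` to
itself. -/
theorem mainTheorem4 {𝕜 : Type v} [RCLike 𝕜] {E : Type u} [NormedAddCommGroup E]
    [NormedSpace 𝕜 E] [CompleteSpace E] :
    IsReflexiveSpace 𝕜 E ↔
      ∀ (F : Type u) [NormedAddCommGroup F] [NormedSpace 𝕜 F] [CompleteSpace F]
        (T : E →L[𝕜] F),
        IsUpperSemiFredholm T ↔
          ∃ δ : ℝ, 0 < δ ∧
            ¬ ∃ e : ℕ → E, IsBasicSequence 𝕜 e ∧ (∀ n, ‖e n‖ = 1) ∧ ∀ n, ‖T (e n)‖ < δ := by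
  constructor
  · intro hE F _ _ _ T
    refine ⟨fun hT ↦ hT.exists_pos_of_isReflexiveSpace hE, fun ⟨δ, hδ, hno⟩ ↦ ?_⟩
    by_contra hT
    exact hno (exists_isBasicSequence_of_not_isUpperSemiFredholm T hT hδ)
  · intro h
    by_contra hE
    obtain ⟨T, hT, hsmall⟩ := exists_isUpperSemiFredholm_of_not_isReflexiveSpace hE
    obtain ⟨δ, hδ, hno⟩ := (h E T).1 hT
    exact hno (hsmall δ hδ)
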